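/- For an irrational $\alpha\in(0,1)$ with regular continued fraction expansion $\alpha=[a_1,a_2,\ldots]$ let $q_n=q_n(\alpha)$ be the denominators of its convergents, that is $q_{-1}=0$, $q_0=1$ and $q_{n+1}=a_{n+1}q_n+q_{n-1}$ for $n\ge 0$. For $n\geq 1$ put $$W_n(\alpha)=\begin{cases}\dfrac{\log q_{n+1}-\log q_n}{\log q_n}&\text{if } q_{n+1}<2q_n\log q_n,\\[2ex] \dfrac{\max\left\{1,\ \log\log q_n-\log\log\frac{q_{n+1}}{q_n\log q_n}\right\}}{\log q_n}&\text{if } q_{n+1}\geq 2q_n\log q_n,\end{cases}$$ where, in the case $q_n=1$ (possible only for $n=1$, $a_1=1$), in which the formula is undefined, we set $W_n(\alpha)=0$. All $W_n(\alpha)$ are nonnegative. Then the set $$E=\Big\{\alpha\in(0,1)\setminus\mathbb{Q}:\ \sum_{n=1}^{\infty}W_n(\alpha)<\infty\Big\}$$ has Lebesgue measure zero, and its Hausdorff dimension is $\dim_{\mathrm H}(E)=\frac12$. -/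

import Mathlib

/-- The denominator `q_n` of the `n`-th convergent of the regular continued fraction
expansion of `α`, with `q_0 = 1` and, for `α ∈ (0,1)`, `q_1 = a_1`. -/
noncomputable def cfDen (α : ℝ) (n : ℕ) : ℝ := (GenContFract.of α).dens n

/-- The weights `W_n(α)`. For irrational `α ∈ (0,1)` and `n ≥ 1` the formula is meaningful and
nonnegative except when `q_n = 1`, which happens only for `n = 1`, `a_1 = 1`; the division by
`log 1 = 0` makes that single term equal to `0`, i.e. it is omitted. -/
noncomputable def W (α : ℝ) (n : ℕ) : ℝ :=
  if cfDen α (n + 1) < 2 * cfDen α n * Real.log (cfDen α n) then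
    (Real.log (cfDen α (n + 1)) - Real.log (cfDen α n)) / Real.log (cfDen α n)
  else
    max 1 (Real.log (Real.log (cfDen α n)) -
        Real.log (Real.log (cfDen α (n + 1) / (cfDen α n * Real.log (cfDen α n))))) /
      Real.log (cfDen α n)

/-- The irrational `α ∈ (0,1)` with `∑_{n ≥ 1} W_n(α) < ∞`. -/
def finiteWSet : Set ℝ :=
  {α | α ∈ Set.Ioo (0 : ℝ) 1 ∧ Irrational α ∧ Summable fun n : ℕ => W α (n + 1)}

/-! Upper bound: once `log q_n` is large, a partial quotient at most `M` falls in the first case of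
`W`, so `W_n log q_n` is the growth `log (q_{n+1}/q_n)`. Summability and monotonicity of `q_n`
therefore force the growth factors at small quotients to have product at most `q_n ^ δ` eventually,
for every `δ > 0`. For `s > 1/2` take `p = s + 1/2 > 1`. Cylinders have diameter at most `q ^ (-2)`,
and with `δ` small their `s`-th powers are dominated by `wordWeight`: the factor `q ^ (-p)` makes
large quotients summable, while a high power of the small part penalises small ones. The total
weight halves at each letter (`tsum_wordWeight_cons_le`), which gives `dimH ≤ s`. Nullity follows,
since the dimension is below 1.

Lower bound: if the `k`-th quotient is of order `2 ^ k`, then `log q_n` grows quadratically and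
`W_n` is `O(n ^ (-3/2))`. These quotients encode mixed radix digits of points of `[0,1)`. Decoding
is Hölder of every exponent `s < 1/2`, because agreement of `n` digits gives distance about `2 ^
(-n²/2)` in `[0,1)` but about `2 ^ (-n²)` between the continued fractions. -/

/-! ### Continued fraction orbits, words and denominators -/

/-- `x` is the sequence of complete remainders of a continued fraction in `(0,1)` with partial
quotients `a n + 1`. -/
structure IsOrbit (a : ℕ → ℕ) (x : ℕ → ℝ) : Prop where
  pos : ∀ n, 0 < x n
  lt_one : ∀ n, x n < 1
  inv_eq : ∀ n, (x n)⁻¹ = a n + 1 + x (n + 1)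

/-- The quotient of two successive denominators, for a reversed word of partial quotients
(each diminished by one). -/
noncomputable def invRatio : List ℕ → ℝ
  | [] => 0
  | a :: l => 1 / (a + 1 + invRatio l)

/-- The denominator attached to a reversed word of partial quotients (each diminished by one). -/
noncomputable def wordDen : List ℕ → ℝ
  | [] => 1
  | a :: l => wordDen l * (a + 1 + invRatio l)

/-- The first `n` terms of a sequence, in reversed order. -/
def hist (a : ℕ → ℕ) : ℕ → List ℕ
  | 0 => []
  | n + 1 => a n :: hist a n

theorem length_hist (a : ℕ → ℕ) (n : ℕ) : (hist a n).length = n := by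
  induction n with
  | zero => rfl
  | succ n ih => simp [hist, ih]

theorem eq_of_hist_eq {a b : ℕ → ℕ} {n : ℕ} (h : hist a n = hist b n) : ∀ k < n, a k = b k := by
  induction n with
  | zero => simp
  | succ n ih =>
    simp only [hist, List.cons.injEq] at h
    intro k hk
    rcases Nat.lt_succ_iff_lt_or_eq.mp hk with h1 | rfl
    · exact ih h.2 k h1
    · exact h.1

theorem invRatio_nonneg (l : List ℕ) : 0 ≤ invRatio l := by
  induction l with
  | nil => simp [invRatio]
  | cons a l ih => unfold invRatio; positivity

theorem invRatio_le_one (l : List ℕ) : invRatio l ≤ 1 := by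
  cases l with
  | nil => simp [invRatio]
  | cons a l =>
    have := invRatio_nonneg l
    have ha : (0 : ℝ) ≤ a := a.cast_nonneg
    unfold invRatio
    rw [div_le_one (by positivity)]
    linarith

theorem one_le_step (a : ℕ) (l : List ℕ) : 1 ≤ (a : ℝ) + 1 + invRatio l := by
  have := invRatio_nonneg l
  have ha : (0 : ℝ) ≤ a := a.cast_nonneg
  linarith

theorem one_le_wordDen (l : List ℕ) : 1 ≤ wordDen l := by
  induction l with
  | nil => simp [wordDen]
  | cons a l ih => exact one_le_mul_of_one_le_of_one_le ih (one_le_step a l)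

theorem wordDen_pos (l : List ℕ) : 0 < wordDen l := zero_lt_one.trans_le (one_le_wordDen l)

theorem wordDen_le_cons (a : ℕ) (l : List ℕ) : wordDen l ≤ wordDen (a :: l) :=
  le_mul_of_one_le_right (wordDen_pos l).le (one_le_step a l)

theorem wordDen_mul_invRatio (a : ℕ) (l : List ℕ) :
    wordDen (a :: l) * invRatio (a :: l) = wordDen l := by
  have := one_le_step a l
  simp only [wordDen, invRatio]
  field_simp

theorem wordDen_cons_cons (a b : ℕ) (l : List ℕ) :
    wordDen (a :: b :: l) = (a + 1) * wordDen (b :: l) + wordDen l := by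
  rw [← wordDen_mul_invRatio b l, wordDen]
  ring

/-- The two-term recurrence adds an earlier denominator, at least 1, at every step after the first.
This makes cylinders shrink uniformly in their length. -/
theorem length_le_wordDen (l : List ℕ) : (l.length : ℝ) ≤ wordDen l := by
  induction l with
  | nil => simp [wordDen]
  | cons a l ih =>
    cases l with
    | nil => simpa using one_le_wordDen [a]
    | cons b l =>
      rw [wordDen_cons_cons]
      have h1 := one_le_wordDen l
      have h2 := wordDen_pos (b :: l)
      have ha : (0 : ℝ) ≤ a := a.cast_nonneg
      have : 0 ≤ (a : ℝ) * wordDen (b :: l) := by positivity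
      rw [List.length_cons]
      push_cast at ih ⊢
      linarith

theorem exists_isOrbit_of_irrational {α : ℝ} (h0 : 0 < α) (h1 : α < 1) (hα : Irrational α) :
    ∃ a x, IsOrbit a x ∧ x 0 = α := by
  let x : ℕ → ℝ := fun n => (fun y : ℝ => Int.fract y⁻¹)^[n] α
  have hs : ∀ n, x (n + 1) = Int.fract (x n)⁻¹ := fun n => Function.iterate_succ_apply' _ _ _
  have hirr : ∀ n, Irrational (x n) := by
    intro n
    induction n with
    | zero => exact hα
    | succ n ih =>
      rw [hs, Int.fract]
      exact (irrational_inv_iff.mpr ih).sub_intCast _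
  have hx : ∀ n, 0 < x n ∧ x n < 1 := by
    intro n
    cases n with
    | zero => exact ⟨h0, h1⟩
    | succ n =>
      refine ⟨lt_of_le_of_ne ?_ (hirr (n + 1)).ne_zero.symm, ?_⟩
      · rw [hs]; exact Int.fract_nonneg _
      · rw [hs]; exact Int.fract_lt_one _
  -- The truncated subtraction is harmless: each inverse remainder is at least 1, hence so is its
  -- floor.
  refine ⟨fun n => ⌊(x n)⁻¹⌋₊ - 1, x, ⟨fun n => (hx n).1, fun n => (hx n).2, fun n => ?_⟩, rfl⟩
  have hinv : 1 ≤ (x n)⁻¹ := (one_le_inv₀ (hx n).1).mpr (hx n).2.le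
  have hfl : 1 ≤ ⌊(x n)⁻¹⌋₊ := Nat.one_le_floor_iff _ |>.mpr hinv
  rw [hs]
  push_cast [hfl]
  rw [natCast_floor_eq_intCast_floor (by positivity)]
  have := Int.floor_add_fract (x n)⁻¹
  linarith

theorem exists_remainders (n : ℕ) : ∀ a : ℕ → ℕ, ∃ x : ℕ → ℝ, (∀ k, x k ∈ Set.Icc (0 : ℝ) 1) ∧
    ∀ k < n, x k * (a k + 1 + x (k + 1)) = 1 := by
  induction n with
  | zero => exact fun a => ⟨fun _ => 0, by simp, by simp⟩
  | succ n ih =>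
    intro a
    obtain ⟨x, hx, hx'⟩ := ih (fun k => a (k + 1))
    have h0 := (hx 0).1
    have ha : (0 : ℝ) ≤ a 0 := (a 0).cast_nonneg
    have hp : 1 ≤ (a 0 : ℝ) + 1 + x 0 := by linarith
    refine ⟨fun k => Nat.casesOn k (1 / (a 0 + 1 + x 0)) x, fun k => ?_, fun k hk => ?_⟩
    · cases k with
      | zero => exact ⟨by change 0 ≤ 1 / _; positivity, by
          change 1 / _ ≤ (1 : ℝ)
          rw [div_le_one (by positivity)]; exact hp⟩
      | succ k => exact hx k
    · cases k with
      | zero =>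
        change 1 / (a 0 + 1 + x 0) * (a 0 + 1 + x 0) = 1
        field_simp
      | succ k => exact hx' k (by omega)

/-- Compactness of the cube: the first `n` equations cut out decreasing nonempty closed sets, and a
common point satisfies all of them. The equations themselves then exclude the endpoints 0 and 1. -/
theorem exists_isOrbit (a : ℕ → ℕ) : ∃ x, IsOrbit a x := by
  let F : ℕ → Set (ℕ → ℝ) := fun n => (Set.univ.pi fun _ => Set.Icc (0 : ℝ) 1) ∩
    {x | ∀ k < n, x k * (a k + 1 + x (k + 1)) = 1}
  have hcl : ∀ n, IsClosed (F n) := by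
    intro n
    refine (isClosed_set_pi fun _ _ => isClosed_Icc).inter ?_
    simp only [Set.ofPred_forall]
    refine isClosed_iInter fun k => isClosed_iInter fun _ => ?_
    exact isClosed_eq (by fun_prop) continuous_const
  have hne : (⋂ n, F n).Nonempty := by
    refine IsCompact.nonempty_iInter_of_sequence_nonempty_isCompact_isClosed F ?_ ?_ ?_ hcl
    · exact fun n x hx => ⟨hx.1, fun k hk => hx.2 k (by omega)⟩
    · intro n
      obtain ⟨x, hx, hx'⟩ := exists_remainders n a
      exact ⟨x, fun k _ => hx k, hx'⟩
    · exact (isCompact_univ_pi fun _ => isCompact_Icc).inter_right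
        (by simp only [Set.ofPred_forall]; simp)
  obtain ⟨x, hx⟩ := hne
  simp only [Set.mem_iInter] at hx
  have hI : ∀ k, x k ∈ Set.Icc (0 : ℝ) 1 := fun k => (hx 0).1 k trivial
  have hE : ∀ k, x k * (a k + 1 + x (k + 1)) = 1 := fun k => (hx (k + 1)).2 k (by omega)
  have hpos : ∀ k, 0 < x k := fun k => lt_of_le_of_ne (hI k).1 fun h => by
    have := hE k
    rw [← h] at this
    simp at this
  refine ⟨x, hpos, fun k => ?_, fun k => inv_eq_of_mul_eq_one_right (hE k)⟩
  have h1 := hE k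
  have h2 := hpos k
  have h3 := mul_pos h2 (hpos (k + 1))
  have h4 : (0 : ℝ) ≤ x k * a k := by positivity
  nlinarith

namespace IsOrbit

variable {a b : ℕ → ℕ} {x y : ℕ → ℝ}

theorem fract_inv (h : IsOrbit a x) (n : ℕ) : Int.fract (x n)⁻¹ = x (n + 1) := by
  rw [h.inv_eq, Int.fract_eq_iff]
  exact ⟨(h.pos _).le, h.lt_one _, (a n : ℤ) + 1, by push_cast; ring⟩

theorem floor_inv (h : IsOrbit a x) (n : ℕ) : ⌊(x n)⁻¹⌋ = (a n : ℤ) + 1 := by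
  rw [h.inv_eq, Int.floor_eq_iff]
  have h1 := h.pos (n + 1)
  have h2 := h.lt_one (n + 1)
  push_cast
  constructor <;> linarith

theorem stream_eq (h : IsOrbit a x) (n : ℕ) :
    ∃ p, GenContFract.IntFractPair.stream (x 0) n = some p ∧ p.fr = x n := by
  induction n with
  | zero =>
    exact ⟨_, rfl, Int.fract_eq_self.mpr ⟨(h.pos 0).le, h.lt_one 0⟩⟩
  | succ n ih =>
    obtain ⟨p, hp, hp'⟩ := ih
    refine ⟨_, GenContFract.IntFractPair.stream_succ_of_some hp (hp' ▸ (h.pos n).ne'), ?_⟩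
    rw [hp']
    exact h.fract_inv n

theorem irrational (h : IsOrbit a x) : Irrational (x 0) := by
  rintro ⟨q, hq⟩
  obtain ⟨n, hn⟩ := (GenContFract.terminates_iff_rat (x 0)).mpr ⟨q, hq.symm⟩
  have hn := GenContFract.of_terminatedAt_n_iff_succ_nth_intFractPair_stream_eq_none.mp hn
  obtain ⟨p, hp, -⟩ := h.stream_eq (n + 1)
  simp [hp] at hn

theorem get?_eq (h : IsOrbit a x) (n : ℕ) :
    (GenContFract.of (x 0)).s.get? n = some ⟨1, a n + 1⟩ := by
  obtain ⟨p, hp, hp'⟩ := h.stream_eq n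
  rw [GenContFract.get?_of_eq_some_of_get?_intFractPair_stream_fr_ne_zero hp
    (hp' ▸ (h.pos n).ne'), hp']
  simp [GenContFract.IntFractPair.of, h.floor_inv]

theorem cfDen_eq (h : IsOrbit a x) (n : ℕ) : cfDen (x 0) n = wordDen (hist a n) := by
  induction n using Nat.twoStepInduction with
  | zero => simp [cfDen, hist, wordDen]
  | one =>
    simp [cfDen, hist, wordDen, invRatio, GenContFract.first_den_eq (h.get?_eq 0)]
  | more n ih1 ih2 =>
    rw [cfDen, GenContFract.dens_recurrence (h.get?_eq (n + 1)) ih1 ih2]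
    simp only [hist]
    rw [wordDen_cons_cons]
    ring

/-- This is the classical `x_0 ⋯ x_{n-1} (q_n + x_n q_{n-1}) = 1`, since `invRatio` is
`q_{n-1}/q_n`. -/
theorem prod_mul_wordDen (h : IsOrbit a x) (n : ℕ) :
    (∏ k ∈ Finset.range n, x k) * (wordDen (hist a n) * (1 + x n * invRatio (hist a n))) = 1 := by
  induction n with
  | zero => simp [hist, wordDen, invRatio]
  | succ n ih =>
    have h1 := h.inv_eq n
    have h2 := h.pos n
    have h3 : x n * (a n + 1 + x (n + 1)) = 1 := by rw [← h1]; field_simp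
    have h4 := wordDen_mul_invRatio (a n) (hist a n)
    have h5 : wordDen (hist a (n + 1)) = wordDen (hist a n) * (a n + 1 + invRatio (hist a n)) := rfl
    rw [← hist] at h4
    rw [Finset.prod_range_succ, mul_add, mul_one, mul_left_comm (wordDen _), h4, h5]
    linear_combination ih + (∏ k ∈ Finset.range n, x k) * wordDen (hist a n) * h3

theorem prod_le (h : IsOrbit a x) (n : ℕ) :
    ∏ k ∈ Finset.range n, x k ≤ (wordDen (hist a n))⁻¹ := by
  have hP : 0 < ∏ k ∈ Finset.range n, x k := Finset.prod_pos fun k _ => h.pos k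
  have hq := wordDen_pos (hist a n)
  have hu := invRatio_nonneg (hist a n)
  have hx := h.pos n
  rw [← one_div, le_div_iff₀ hq, ← h.prod_mul_wordDen n]
  gcongr
  exact le_mul_of_one_le_right hq.le (by nlinarith)

/-- Under a common letter, inversion turns a difference of remainders into the next one times `x n *
y n`. -/
theorem abs_sub_eq (hx : IsOrbit a x) (hy : IsOrbit b y) {n : ℕ} (hab : ∀ k < n, a k = b k) :
    |x 0 - y 0| =
      (∏ k ∈ Finset.range n, x k) * (∏ k ∈ Finset.range n, y k) * |x n - y n| := by
  induction n with
  | zero => simp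
  | succ n ih =>
    rw [ih fun k hk => hab k (by omega), Finset.prod_range_succ, Finset.prod_range_succ]
    have h1 := hx.inv_eq n
    have h2 := hy.inv_eq n
    have h3 := hx.pos n
    have h4 := hy.pos n
    rw [← hab n (by omega)] at h2
    have h5 : x n - y n = x n * y n * (y (n + 1) - x (n + 1)) := by
      have : y (n + 1) - x (n + 1) = (y n)⁻¹ - (x n)⁻¹ := by rw [h1, h2]; ring
      rw [this]
      field_simp
    rw [h5, abs_mul, abs_of_pos (mul_pos h3 h4), abs_sub_comm]
    ring

end IsOrbit

open Filter Topology MeasureTheory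
open scoped ENNReal NNReal

/-! ### Contracting weights on words -/

/-- The product of the quotients of successive denominators over the places of a reversed word
where the partial quotient is at most `M`. -/
noncomputable def smallPart (M : ℕ) : List ℕ → ℝ
  | [] => 1
  | a :: l => (if a < M then a + 1 + invRatio l else 1) * smallPart M l

/-- A boundary factor, larger when the last partial quotient exceeds `M`. -/
noncomputable def boundaryFactor (M : ℕ) : List ℕ → ℝ
  | [] => 8
  | a :: _ => if a < M then 1 else 8

/-- The weight of a word, which dominates a power of the denominator on words with few small
partial quotients, and whose sum over one-letter extensions is contracting. -/
noncomputable def wordWeight (M T : ℕ) (p : ℝ) (l : List ℕ) : ℝ :=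
  boundaryFactor M l * (wordDen l ^ (-p) * (smallPart M l ^ T)⁻¹)

theorem one_le_smallPart (M : ℕ) (l : List ℕ) : 1 ≤ smallPart M l := by
  induction l with
  | nil => simp [smallPart]
  | cons a l ih =>
    refine one_le_mul_of_one_le_of_one_le ?_ ih
    split_ifs
    · exact one_le_step a l
    · exact le_rfl

theorem one_le_boundaryFactor (M : ℕ) (l : List ℕ) : 1 ≤ boundaryFactor M l := by
  cases l with
  | nil => norm_num [boundaryFactor]
  | cons a l => simp only [boundaryFactor]; split_ifs <;> norm_num

theorem wordWeight_cons_small {M T : ℕ} {p : ℝ} (hp : 0 ≤ p) {a : ℕ} (ha : a < M) (l : List ℕ) :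
    wordWeight M T p (a :: l) ≤
      wordDen l ^ (-p) * (smallPart M l ^ T)⁻¹ * (((a : ℝ) + 1 + invRatio l) ^ T)⁻¹ := by
  have hr := one_le_step a l
  have hq := wordDen_pos l
  have hs := one_le_smallPart M l
  have hrp : ((a : ℝ) + 1 + invRatio l) ^ (-p) ≤ 1 :=
    Real.rpow_le_one_of_one_le_of_nonpos hr (by linarith)
  simp only [wordWeight, boundaryFactor, wordDen, smallPart, if_pos ha]
  rw [Real.mul_rpow hq.le (by linarith), mul_pow, mul_inv, one_mul]
  calc _ = wordDen l ^ (-p) * (smallPart M l ^ T)⁻¹ * (((a : ℝ) + 1 + invRatio l) ^ T)⁻¹ *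
        ((a : ℝ) + 1 + invRatio l) ^ (-p) := by ring
    _ ≤ _ := mul_le_of_le_one_right (by positivity) hrp

theorem wordWeight_cons_large {M T : ℕ} {p : ℝ} (hp : 0 ≤ p) {a : ℕ} (ha : ¬ a < M) (l : List ℕ) :
    wordWeight M T p (a :: l) ≤
      wordDen l ^ (-p) * (smallPart M l ^ T)⁻¹ * (8 * ((a : ℝ) + 1) ^ (-p)) := by
  have hr := one_le_step a l
  have hq := wordDen_pos l
  have hs := one_le_smallPart M l
  have hu := invRatio_nonneg l
  have hrp : ((a : ℝ) + 1 + invRatio l) ^ (-p) ≤ ((a : ℝ) + 1) ^ (-p) :=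
    Real.rpow_le_rpow_of_nonpos (by positivity) (by linarith) (by linarith)
  simp only [wordWeight, boundaryFactor, wordDen, smallPart, if_neg ha]
  rw [Real.mul_rpow hq.le (by linarith), one_mul]
  calc _ = wordDen l ^ (-p) * (smallPart M l ^ T)⁻¹ * (8 *
        ((a : ℝ) + 1 + invRatio l) ^ (-p)) := by ring
    _ ≤ _ := by gcongr

/-- Parameters for which the weights of words are contracting. -/
theorem exists_contraction_parameters {p : ℝ} (hp : 1 < p) : ∃ M T : ℕ,
    ∑' a : ℕ, ENNReal.ofReal ((((a + M : ℕ) : ℝ) + 1) ^ (-p)) ≤ ENNReal.ofReal (1 / 20) ∧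
    (((1 : ℝ) + 1 / (M + 1)) ^ T)⁻¹ ≤ 1 / (20 * (M + 1)) := by
  have hsum : Summable fun a : ℕ => ((a : ℝ) + 1) ^ (-p) := by
    have := (summable_nat_add_iff 1).mpr (Real.summable_nat_rpow.mpr (by linarith : -p < -1))
    simpa using this
  have ht := tendsto_sum_nat_add fun a : ℕ => ((a : ℝ) + 1) ^ (-p)
  obtain ⟨M, hM⟩ := (ht.eventually (ge_mem_nhds (by norm_num : (0 : ℝ) < 1 / 20))).exists
  have hpos : (1 : ℝ) < 1 + 1 / (M + 1) := by
    have : (0 : ℝ) < 1 / (M + 1) := by positivity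
    linarith
  -- `T` is large enough that at most `M` small letters, each with growth at least `1 + 1/(M+1)`,
  -- have total weight at most `1/20`.
  obtain ⟨T, hT⟩ := pow_unbounded_of_one_lt (20 * ((M : ℝ) + 1)) hpos
  refine ⟨M, T, ?_, ?_⟩
  · rw [← ENNReal.ofReal_tsum_of_nonneg (fun a => by positivity)
      ((summable_nat_add_iff M).mpr hsum)]
    exact ENNReal.ofReal_le_ofReal hM
  · rw [← one_div]
    exact one_div_le_one_div_of_le (by positivity) hT.le

/-- Large letters cost at most `8/20`. Small ones cost at most `1/20`, except that the letter 0 may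
cost 1 when `invRatio l` is tiny. This happens only for the empty word or after a large letter,
where the boundary factor 8 pays for it: `9/20 ≤ 1/2` and `1 + 9/20 ≤ 8/2`. -/
theorem tsum_wordWeight_cons_le {M T : ℕ} {p : ℝ} (hp : 0 ≤ p)
    (htail : ∑' a : ℕ, ENNReal.ofReal ((((a + M : ℕ) : ℝ) + 1) ^ (-p)) ≤ ENNReal.ofReal (1 / 20))
    (hT : (((1 : ℝ) + 1 / (M + 1)) ^ T)⁻¹ ≤ 1 / (20 * (M + 1))) (l : List ℕ) :
    ∑' a : ℕ, ENNReal.ofReal (wordWeight M T p (a :: l)) ≤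
      ENNReal.ofReal (1 / 2) * ENNReal.ofReal (wordWeight M T p l) := by
  set P : ℝ := wordDen l ^ (-p) * (smallPart M l ^ T)⁻¹ with hP
  have hq := wordDen_pos l
  have hs := one_le_smallPart M l
  have hP0 : 0 ≤ P := by positivity
  have hlarge : ∑' a : ℕ, ENNReal.ofReal (wordWeight M T p ((a + M) :: l)) ≤
      ENNReal.ofReal (P * (8 / 20)) := by
    calc _ ≤ ∑' a : ℕ, ENNReal.ofReal (P * 8) *
          ENNReal.ofReal ((((a + M : ℕ) : ℝ) + 1) ^ (-p)) := by
          refine ENNReal.tsum_le_tsum fun a => ?_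
          rw [← ENNReal.ofReal_mul (by positivity), mul_assoc]
          exact ENNReal.ofReal_le_ofReal (wordWeight_cons_large hp (by omega) l)
      _ ≤ ENNReal.ofReal (P * 8) * ENNReal.ofReal (1 / 20) := by
          rw [ENNReal.tsum_mul_left]; gcongr
      _ = _ := by rw [← ENNReal.ofReal_mul (by positivity)]; congr 1; ring
  have hM0 : (0 : ℝ) ≤ M := M.cast_nonneg
  have hρ : 0 < (1 : ℝ) + 1 / (M + 1) := by positivity
  have hMT : (M : ℝ) * (((1 : ℝ) + 1 / (M + 1)) ^ T)⁻¹ ≤ 1 / 20 := by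
    calc _ ≤ (M : ℝ) * (1 / (20 * (M + 1))) := by gcongr
      _ ≤ 1 / 20 := by
        rw [mul_one_div, div_le_div_iff₀ (by positivity) (by norm_num)]
        linarith
  have hsmall : ∑ a ∈ Finset.range M, wordWeight M T p (a :: l) ≤
      P * (boundaryFactor M l / 2 - 8 / 20) := by
    have hterm : ∀ a ∈ Finset.range M, wordWeight M T p (a :: l) ≤
        P * (((a : ℝ) + 1 + invRatio l) ^ T)⁻¹ := fun a ha =>
      wordWeight_cons_small hp (Finset.mem_range.mp ha) l
    have hu := invRatio_nonneg l
    refine (Finset.sum_le_sum hterm).trans ?_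
    rw [← Finset.mul_sum]
    gcongr
    by_cases hcase : 1 / ((M : ℝ) + 1) ≤ invRatio l
    · have h1 := one_le_boundaryFactor M l
      calc _ ≤ ∑ a ∈ Finset.range M, (((1 : ℝ) + 1 / (M + 1)) ^ T)⁻¹ := by
            refine Finset.sum_le_sum fun a _ => ?_
            have ha : (0 : ℝ) ≤ a := a.cast_nonneg
            gcongr
            linarith
        _ ≤ 1 / 20 := by simpa using hMT
        _ ≤ _ := by linarith
    -- A small last letter would give `invRatio l ≥ 1/(M+1)`.
    · have h8 : boundaryFactor M l = 8 := by
        cases l with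
        | nil => rfl
        | cons b l =>
          simp only [boundaryFactor]
          rw [if_neg]
          intro hb
          apply hcase
          have h1 := invRatio_le_one l
          have h2 := invRatio_nonneg l
          have h3 : (b : ℝ) + 1 ≤ M := by exact_mod_cast hb
          simp only [invRatio]
          gcongr
      rw [h8]
      calc _ ≤ ∑ a ∈ Finset.range M, ((((1 : ℝ) + 1 / (M + 1)) ^ T)⁻¹ + if a = 0 then 1 else 0) := by
            refine Finset.sum_le_sum fun a _ => ?_
            have hinv : 0 ≤ (((1 : ℝ) + 1 / (M + 1)) ^ T)⁻¹ := by positivity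
            split_ifs with h0
            · have : (((a : ℝ) + 1 + invRatio l) ^ T)⁻¹ ≤ 1 :=
                inv_le_one_of_one_le₀ (one_le_pow₀ (one_le_step a l))
              linarith
            · have ha : (1 : ℝ) ≤ a := by exact_mod_cast Nat.one_le_iff_ne_zero.mpr h0
              have hM1 : 1 / ((M : ℝ) + 1) ≤ 1 := by
                rw [div_le_one (by positivity)]; linarith
              rw [add_zero]
              have hle : (1 : ℝ) + 1 / (M + 1) ≤ a + 1 + invRatio l := by linarith
              gcongr
        _ ≤ 1 / 20 + 1 := by
            rw [Finset.sum_add_distrib]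
            refine add_le_add (by simpa using hMT) ?_
            rw [Finset.sum_ite_eq']
            split_ifs <;> norm_num
        _ ≤ _ := by norm_num
  have hb := one_le_boundaryFactor M l
  calc _ = ∑ a ∈ Finset.range M, ENNReal.ofReal (wordWeight M T p (a :: l)) +
        ∑' a : ℕ, ENNReal.ofReal (wordWeight M T p ((a + M) :: l)) :=
        (Summable.sum_add_tsum_nat_add' (f := fun a => ENNReal.ofReal (wordWeight M T p (a :: l)))
          ENNReal.summable).symm
    _ ≤ ENNReal.ofReal (P * (boundaryFactor M l / 2 - 8 / 20)) + ENNReal.ofReal (P * (8 / 20)) := by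
        refine add_le_add ?_ hlarge
        rw [← ENNReal.ofReal_sum_of_nonneg]
        · exact ENNReal.ofReal_le_ofReal hsmall
        · intro a _
          have h1 := wordDen_pos (a :: l)
          have h2 := one_le_smallPart M (a :: l)
          have h3 := one_le_boundaryFactor M (a :: l)
          unfold wordWeight
          positivity
    _ = _ := by
        rw [← ENNReal.ofReal_add (mul_nonneg hP0 (by linarith)) (by positivity),
          ← ENNReal.ofReal_mul (by norm_num), wordWeight, ← hP]
        congr 1
        ring

/-- Words of length `n + 1` are words of length `n` extended by one letter. -/
def wordConsEquiv (n : ℕ) :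
    {l : List ℕ // l.length = n} × ℕ ≃ {l : List ℕ // l.length = n + 1} where
  toFun z := ⟨z.2 :: z.1.1, by simp [z.1.2]⟩
  invFun l := (⟨l.1.tail, by simp [l.2]⟩, l.1.head (List.ne_nil_of_length_eq_add_one l.2))
  left_inv z := by simp
  right_inv l := by simp

theorem tsum_wordWeight_le {M T : ℕ} {p : ℝ} (hp : 0 ≤ p)
    (htail : ∑' a : ℕ, ENNReal.ofReal ((((a + M : ℕ) : ℝ) + 1) ^ (-p)) ≤ ENNReal.ofReal (1 / 20))
    (hT : (((1 : ℝ) + 1 / (M + 1)) ^ T)⁻¹ ≤ 1 / (20 * (M + 1))) (n : ℕ) :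
    ∑' l : {l : List ℕ // l.length = n}, ENNReal.ofReal (wordWeight M T p l) ≤
      ENNReal.ofReal (8 * (1 / 2) ^ n) := by
  induction n with
  | zero =>
    have : Unique {l : List ℕ // l.length = 0} :=
      ⟨⟨⟨[], rfl⟩⟩, fun l => Subtype.ext (List.length_eq_zero_iff.mp l.2)⟩
    rw [tsum_eq_single ⟨[], rfl⟩ fun b hb => (hb (Subsingleton.elim _ _)).elim]
    simp [wordWeight, boundaryFactor, wordDen, smallPart]
  | succ n ih =>
    rw [← (wordConsEquiv n).tsum_eq, ENNReal.tsum_prod']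
    calc _ ≤ ∑' l : {l : List ℕ // l.length = n},
          ENNReal.ofReal (1 / 2) * ENNReal.ofReal (wordWeight M T p l) :=
          ENNReal.tsum_le_tsum fun l => tsum_wordWeight_cons_le hp htail hT l
      _ ≤ ENNReal.ofReal (1 / 2) * ENNReal.ofReal (8 * (1 / 2) ^ n) := by
          rw [ENNReal.tsum_mul_left]; gcongr
      _ = _ := by
          rw [← ENNReal.ofReal_mul (by norm_num)]
          congr 1
          ring

/-! ### Covering numbers with few small quotients -/

/-- Numbers whose partial quotients up to `M` contribute, from the `N`-th step on, at most a power
`δ` of the denominator. -/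
def fewSmallSet (M N : ℕ) (δ : ℝ) : Set ℝ :=
  {α | ∃ a x, IsOrbit a x ∧ x 0 = α ∧
    ∀ n ≥ N, smallPart M (hist a n) ≤ wordDen (hist a n) ^ δ}

/-- The part of `fewSmallSet` in the cylinder given by a word. -/
def fewSmallCylinder (M N : ℕ) (δ : ℝ) (l : List ℕ) : Set ℝ :=
  {α | ∃ a x, IsOrbit a x ∧ x 0 = α ∧ hist a l.length = l ∧
    ∀ n ≥ N, smallPart M (hist a n) ≤ wordDen (hist a n) ^ δ}

theorem ediam_fewSmallCylinder_le (M N : ℕ) (δ : ℝ) (l : List ℕ) :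
    Metric.ediam (fewSmallCylinder M N δ l) ≤ ENNReal.ofReal (wordDen l ^ (-2 : ℝ)) := by
  refine Metric.ediam_le ?_
  rintro _ ⟨a, x, hx, rfl, ha, -⟩ _ ⟨b, y, hy, rfl, hb, -⟩
  rw [edist_dist, Real.dist_eq]
  refine ENNReal.ofReal_le_ofReal ?_
  rw [hx.abs_sub_eq hy (eq_of_hist_eq (ha.trans hb.symm))]
  have h1 := hx.prod_le l.length
  have h2 := hy.prod_le l.length
  rw [ha] at h1
  rw [hb] at h2
  have h3 : |x l.length - y l.length| ≤ 1 := by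
    have := hx.pos l.length
    have := hx.lt_one l.length
    have := hy.pos l.length
    have := hy.lt_one l.length
    rw [abs_le]; constructor <;> linarith
  have hq := wordDen_pos l
  have hy0 : 0 ≤ ∏ k ∈ Finset.range l.length, y k := Finset.prod_nonneg fun k _ => (hy.pos k).le
  calc _ ≤ (wordDen l)⁻¹ * (wordDen l)⁻¹ * 1 := by gcongr
    _ = _ := by rw [Real.rpow_neg hq.le, Real.rpow_two, mul_one, sq, mul_inv]

/-- On a nonempty cylinder the bound on the small part holds for `l` itself, so the spare exponent
`2 * s - p` absorbs its `T`-th power. -/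
theorem ediam_rpow_le_wordWeight {M N T : ℕ} {δ p s : ℝ} (hs : 0 < s) (hδ : δ * T ≤ 2 * s - p)
    {l : List ℕ} (hl : N ≤ l.length) :
    Metric.ediam (fewSmallCylinder M N δ l) ^ s ≤ ENNReal.ofReal (wordWeight M T p l) := by
  rcases (fewSmallCylinder M N δ l).eq_empty_or_nonempty with h | ⟨α, a, x, hx, rfl, ha, hfew⟩
  · simp [h, hs]
  have hq := one_le_wordDen l
  have hq0 := wordDen_pos l
  have hS := one_le_smallPart M l
  have hb := one_le_boundaryFactor M l
  have h1 := hfew _ hl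
  rw [ha] at h1
  calc _ ≤ ENNReal.ofReal (wordDen l ^ (-2 : ℝ)) ^ s := by
        gcongr
        exact ediam_fewSmallCylinder_le M N δ l
    _ = ENNReal.ofReal (wordDen l ^ (-(2 * s))) := by
        rw [ENNReal.ofReal_rpow_of_nonneg (by positivity) hs.le, ← Real.rpow_mul hq0.le]
        congr 2
        ring
    _ ≤ _ := by
        refine ENNReal.ofReal_le_ofReal ?_
        calc wordDen l ^ (-(2 * s)) ≤ wordDen l ^ (-p + -(δ * T)) :=
              Real.rpow_le_rpow_of_exponent_le hq (by linarith)
          _ = wordDen l ^ (-p) * ((wordDen l ^ δ) ^ T)⁻¹ := by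
              rw [Real.rpow_add hq0, Real.rpow_neg hq0.le (δ * T), Real.rpow_mul_natCast hq0.le]
          _ ≤ wordDen l ^ (-p) * (smallPart M l ^ T)⁻¹ := by gcongr
          _ ≤ _ := le_mul_of_one_le_left (by positivity) hb

theorem dimH_fewSmallSet_le {M N T : ℕ} {δ p : ℝ} {s : ℝ≥0} (hs : 0 < s) (hp : 0 ≤ p)
    (hδ : δ * T ≤ 2 * s - p)
    (htail : ∑' a : ℕ, ENNReal.ofReal ((((a + M : ℕ) : ℝ) + 1) ^ (-p)) ≤ ENNReal.ofReal (1 / 20))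
    (hT : (((1 : ℝ) + 1 / (M + 1)) ^ T)⁻¹ ≤ 1 / (20 * (M + 1))) :
    dimH (fewSmallSet M N δ) ≤ s := by
  have hs' : (0 : ℝ) < s := hs
  have key : μH[(s : ℝ)] (fewSmallSet M N δ) ≤ liminf (fun n : ℕ =>
      ∑' l : {l : List ℕ // l.length = n}, Metric.ediam (fewSmallCylinder M N δ l) ^ (s : ℝ))
      atTop := by
    refine Measure.hausdorffMeasure_le_liminf_tsum (s : ℝ) _
      (fun n : ℕ => ENNReal.ofReal ((n : ℝ) ^ (-2 : ℝ))) ?_ _ ?_ ?_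
    · rw [← ENNReal.ofReal_zero]
      exact ENNReal.tendsto_ofReal
        ((tendsto_rpow_neg_atTop two_pos).comp tendsto_natCast_atTop_atTop)
    · filter_upwards [eventually_gt_atTop 0] with n hn l
      refine (ediam_fewSmallCylinder_le M N δ l).trans (ENNReal.ofReal_le_ofReal ?_)
      have h1 := length_le_wordDen l.1
      rw [l.2] at h1
      exact Real.rpow_le_rpow_of_nonpos (by exact_mod_cast hn) h1 (by norm_num)
    · refine Eventually.of_forall fun n α => ?_
      rintro ⟨a, x, hx, hα, h⟩
      simp only [Set.mem_iUnion]
      exact ⟨⟨hist a n, length_hist a n⟩, a, x, hx, hα, by simp [length_hist], h⟩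
  have hlim : Tendsto (fun n : ℕ => ∑' l : {l : List ℕ // l.length = n},
      Metric.ediam (fewSmallCylinder M N δ l) ^ (s : ℝ)) atTop (𝓝 0) := by
    have h0 : Tendsto (fun n : ℕ => ENNReal.ofReal (8 * (1 / 2) ^ n)) atTop (𝓝 0) := by
      rw [← ENNReal.ofReal_zero]
      refine ENNReal.tendsto_ofReal ?_
      simpa using (tendsto_pow_atTop_nhds_zero_of_lt_one (by norm_num : (0 : ℝ) ≤ 1 / 2)
        (by norm_num)).const_mul 8
    refine tendsto_of_tendsto_of_tendsto_of_le_of_le' tendsto_const_nhds h0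
      (Eventually.of_forall fun _ => zero_le) ?_
    filter_upwards [eventually_ge_atTop N] with n hn
    refine le_trans (ENNReal.tsum_le_tsum fun l => ?_) (tsum_wordWeight_le hp htail hT n)
    exact ediam_rpow_le_wordWeight hs' hδ (l.2.symm ▸ hn)
  rw [hlim.liminf_eq] at key
  refine dimH_le_of_hausdorffMeasure_ne_top ?_
  rw [le_antisymm key (zero_le)]
  exact ENNReal.zero_ne_top

/-! ### From summable weights to the upper bound -/

theorem IsOrbit.W_nonneg {a : ℕ → ℕ} {x : ℕ → ℝ} (h : IsOrbit a x) (n : ℕ) : 0 ≤ W (x 0) n := by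
  unfold W
  simp only [h.cfDen_eq]
  have h1 := one_le_wordDen (hist a n)
  have h2 : wordDen (hist a n) ≤ wordDen (hist a (n + 1)) := wordDen_le_cons _ _
  have h3 := Real.log_nonneg h1
  have h4 := Real.log_le_log (by linarith) h2
  split_ifs
  · exact div_nonneg (by linarith) h3
  · exact div_nonneg (zero_le_one.trans (le_max_left _ _)) h3

/-- A small letter multiplies the denominator by at most `M + 1`, so the hypothesis puts `W` in its
first case. A large letter leaves the small part unchanged. -/
theorem IsOrbit.log_smallPart_succ_le {a : ℕ → ℕ} {x : ℕ → ℝ} (h : IsOrbit a x) {M n : ℕ}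
    (hn : (M + 1 : ℝ) < 2 * Real.log (wordDen (hist a n))) :
    Real.log (smallPart M (hist a (n + 1))) ≤
      Real.log (smallPart M (hist a n)) + W (x 0) n * Real.log (wordDen (hist a n)) := by
  have hW := h.W_nonneg n
  have hM : (0 : ℝ) ≤ M := M.cast_nonneg
  have hL : 0 < Real.log (wordDen (hist a n)) := by linarith
  have hq := wordDen_pos (hist a n)
  have hS := one_le_smallPart M (hist a n)
  by_cases hs : a n < M
  · have hr := one_le_step (a n) (hist a n)
    have hr' : (a n : ℝ) + 1 + invRatio (hist a n) ≤ M + 1 := by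
      have := invRatio_le_one (hist a n)
      have : (a n : ℝ) + 1 ≤ M := by exact_mod_cast hs
      linarith
    have hlt : wordDen (hist a (n + 1)) <
        2 * wordDen (hist a n) * Real.log (wordDen (hist a n)) := by
      calc _ = wordDen (hist a n) * (a n + 1 + invRatio (hist a n)) := rfl
        _ ≤ wordDen (hist a n) * (M + 1) := by gcongr
        _ < wordDen (hist a n) * (2 * Real.log (wordDen (hist a n))) := by gcongr
        _ = _ := by ring
    have hWn : W (x 0) n * Real.log (wordDen (hist a n)) =
        Real.log (a n + 1 + invRatio (hist a n)) := by
      unfold W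
      simp only [h.cfDen_eq]
      rw [if_pos hlt, div_mul_cancel₀ _ hL.ne', hist, wordDen,
        Real.log_mul hq.ne' (by linarith)]
      ring
    rw [hWn, hist, smallPart, if_pos hs, Real.log_mul (by linarith) (by linarith)]
    linarith
  · rw [hist, smallPart, if_neg hs, one_mul]
    have := mul_nonneg hW hL.le
    linarith

theorem wordDen_hist_mono (a : ℕ → ℕ) : Monotone fun n => wordDen (hist a n) :=
  monotone_nat_of_le_succ fun _ => wordDen_le_cons _ _

theorem tendsto_log_wordDen_hist (a : ℕ → ℕ) :
    Tendsto (fun n => Real.log (wordDen (hist a n))) atTop atTop := by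
  refine Real.tendsto_log_atTop.comp (tendsto_atTop_mono (fun n => ?_) tendsto_natCast_atTop_atTop)
  simpa [length_hist] using length_le_wordDen (hist a n)

theorem IsOrbit.eventually_smallPart_le {a : ℕ → ℕ} {x : ℕ → ℝ} (h : IsOrbit a x)
    (hW : Summable (W (x 0))) (M : ℕ) {δ : ℝ} (hδ : 0 < δ) :
    ∀ᶠ n in atTop, smallPart M (hist a n) ≤ wordDen (hist a n) ^ δ := by
  set L : ℕ → ℝ := fun n => Real.log (wordDen (hist a n)) with hL
  have hLtop : Tendsto L atTop atTop := tendsto_log_wordDen_hist a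
  have hLmono : Monotone L := fun m n hmn =>
    Real.log_le_log (wordDen_pos _) (wordDen_hist_mono a hmn)
  have hLnonneg : ∀ n, 0 ≤ L n := fun n => Real.log_nonneg (one_le_wordDen _)
  obtain ⟨K₁, hK₁⟩ := (hLtop.eventually_gt_atTop (((M : ℝ) + 1) / 2)).exists_forall_of_atTop
  -- Half of `δ` goes to the tail of the series, the other half to the constant accumulated before
  -- `K`.
  have htail := tendsto_sum_nat_add (W (x 0))
  obtain ⟨K, hKtail, hK⟩ := ((htail.eventually (ge_mem_nhds (half_pos hδ))).and
    (eventually_ge_atTop K₁)).exists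
  have hsum : Summable fun k => W (x 0) (k + K) := (summable_nat_add_iff K).mpr hW
  have hpart : ∀ m, ∑ k ∈ Finset.range m, W (x 0) (k + K) ≤ δ / 2 := fun m =>
    (hsum.sum_le_tsum _ fun k _ => h.W_nonneg _).trans hKtail
  have hind : ∀ m, Real.log (smallPart M (hist a (m + K))) ≤
      Real.log (smallPart M (hist a K)) +
        L (m + K) * ∑ k ∈ Finset.range m, W (x 0) (k + K) := by
    intro m
    induction m with
    | zero => simp
    | succ m ih =>
      have h1 : Real.log (smallPart M (hist a (m + 1 + K))) ≤
          Real.log (smallPart M (hist a (m + K))) + W (x 0) (m + K) * L (m + K) := by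
        rw [show m + 1 + K = m + K + 1 by ring]
        refine h.log_smallPart_succ_le ?_
        have := hK₁ (m + K) (by omega)
        simp only [hL] at this
        linarith
      have h2 : L (m + K) ≤ L (m + 1 + K) := hLmono (by omega)
      have h3 : 0 ≤ ∑ k ∈ Finset.range (m + 1), W (x 0) (k + K) :=
        Finset.sum_nonneg fun k _ => h.W_nonneg _
      have h4 := mul_le_mul_of_nonneg_right h2 h3
      rw [Finset.sum_range_succ] at h4 ⊢
      linarith
  filter_upwards [eventually_ge_atTop K,
    hLtop.eventually_ge_atTop (2 / δ * Real.log (smallPart M (hist a K)))] with n hn hn'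
  obtain ⟨m, rfl⟩ := Nat.exists_eq_add_of_le' hn
  have hS := one_le_smallPart M (hist a (m + K))
  rw [← Real.log_le_log_iff (by linarith) (Real.rpow_pos_of_pos (wordDen_pos _) _),
    Real.log_rpow (wordDen_pos _)]
  have h1 := mul_le_mul_of_nonneg_left (hpart m) (hLnonneg (m + K))
  have h2 := mul_le_mul_of_nonneg_left hn' (half_pos hδ).le
  have h3 : δ / 2 * (2 / δ * Real.log (smallPart M (hist a K))) =
      Real.log (smallPart M (hist a K)) := by field_simp
  have h4 := hind m
  change _ ≤ δ * L (m + K)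
  linarith

theorem dimH_finiteWSet_le_of_half_lt {s : ℝ≥0} (hs : (1 / 2 : ℝ) < s) :
    dimH finiteWSet ≤ s := by
  obtain ⟨M, T, htail, hT⟩ := exists_contraction_parameters (p := s + 1 / 2) (by linarith)
  -- With `p = s + 1/2` the spare exponent `2 * s - p` is `s - 1/2`. The denominator `T + 1` allows
  -- `T = 0`.
  set δ : ℝ := (s - 1 / 2) / (T + 1) with hδ
  have hδ0 : 0 < δ := div_pos (by linarith) (by positivity)
  have hsub : finiteWSet ⊆ ⋃ N, fewSmallSet M N δ := by
    rintro α ⟨⟨h0, h1⟩, hirr, hW⟩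
    obtain ⟨a, x, hx, rfl⟩ := exists_isOrbit_of_irrational h0 h1 hirr
    obtain ⟨N, hN⟩ := (hx.eventually_smallPart_le ((summable_nat_add_iff 1).mp hW) M
      hδ0).exists_forall_of_atTop
    exact Set.mem_iUnion.mpr ⟨N, a, x, hx, rfl, hN⟩
  refine (dimH_mono hsub).trans ?_
  rw [dimH_iUnion]
  refine iSup_le fun N => dimH_fewSmallSet_le (p := s + 1 / 2) (T := T) ?_ (by positivity) ?_
    htail hT
  · exact_mod_cast (by linarith : (0 : ℝ) < s)
  · have : δ * (T + 1) = s - 1 / 2 := by rw [hδ]; field_simp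
    linarith

theorem dimH_finiteWSet_le : dimH finiteWSet ≤ 1 / 2 := by
  refine le_of_forall_gt_imp_ge_of_dense fun c hc => ?_
  induction c with
  | top => exact le_top
  | coe c =>
    refine dimH_finiteWSet_le_of_half_lt ?_
    have h2 : ((1 / 2 : ℝ≥0) : ℝ≥0∞) < c := by
      rw [ENNReal.coe_div two_ne_zero]
      simpa using hc
    have h3 : (1 / 2 : ℝ≥0) < c := ENNReal.coe_lt_coe.mp h2
    exact_mod_cast h3

theorem volume_finiteWSet : volume finiteWSet = 0 := by
  refine measure_zero_of_dimH_lt (d := 1) ?_ (dimH_finiteWSet_le.trans_lt ?_)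
  · rw [NNReal.coe_one, hausdorffMeasure_real]
  · rw [ENNReal.coe_one]
    exact ENNReal.div_lt_of_lt_mul (by norm_num)
-- Mixed radix digits and the Hölder estimate
-- The hypothesis makes `g` injective on `A` with an `s`-Hölder inverse.
theorem dimH_le_of_abs_sub_le {A : Set ℝ} {g : ℝ → ℝ} {C s : ℝ≥0} (hs : 0 < s)
    (h : ∀ y ∈ A, ∀ z ∈ A, |y - z| ≤ C * |g y - g z| ^ (s : ℝ)) :
    dimH A ≤ dimH (g '' A) / s := by
  have hs' : (s : ℝ) ≠ 0 := by exact_mod_cast hs.ne'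
  have hinj : Set.InjOn g A := by
    intro y hy z hz hyz
    have h1 := h y hy z hz
    rw [hyz, sub_self, abs_zero, Real.zero_rpow hs', mul_zero] at h1
    exact sub_eq_zero.mp (abs_eq_zero.mp (le_antisymm h1 (abs_nonneg _)))
  have hH : HolderOnWith C s (Function.invFunOn g A) (g '' A) := by
    rintro _ ⟨y, hy, rfl⟩ _ ⟨z, hz, rfl⟩
    rw [hinj.leftInvOn_invFunOn hy, hinj.leftInvOn_invFunOn hz, edist_dist, edist_dist,
      Real.dist_eq, Real.dist_eq, ENNReal.ofReal_rpow_of_nonneg (abs_nonneg _) s.coe_nonneg,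
      ← ENNReal.ofReal_coe_nnreal, ← ENNReal.ofReal_mul C.coe_nonneg]
    exact ENNReal.ofReal_le_ofReal (h y hy z hz)
  have := hH.dimH_image_le hs
  rwa [hinj.invFunOn_image subset_rfl] at this

/-- The remainders of the mixed radix expansion with bases `2, 4, 8, …`. -/
noncomputable def radixRem (y : ℝ) : ℕ → ℝ
  | 0 => y
  | n + 1 => Int.fract (2 ^ (n + 1) * radixRem y n)

/-- The digits of the mixed radix expansion with bases `2, 4, 8, …`, shifted so that the `n`-th one
lies in `[2 ^ (n + 1), 2 ^ (n + 2))`. -/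
noncomputable def radixDigit (y : ℝ) (n : ℕ) : ℕ :=
  2 ^ (n + 1) + ⌊2 ^ (n + 1) * radixRem y n⌋₊

theorem radixRem_mem {y : ℝ} (hy : y ∈ Set.Ico (0 : ℝ) 1) (n : ℕ) :
    radixRem y n ∈ Set.Ico (0 : ℝ) 1 := by
  cases n with
  | zero => exact hy
  | succ n => exact ⟨Int.fract_nonneg _, Int.fract_lt_one _⟩

theorem radixDigit_lt {y : ℝ} (hy : y ∈ Set.Ico (0 : ℝ) 1) (n : ℕ) :
    radixDigit y n < 2 ^ (n + 2) := by
  have h := radixRem_mem hy n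
  have h1 : ⌊2 ^ (n + 1) * radixRem y n⌋₊ < 2 ^ (n + 1) := by
    rw [Nat.floor_lt (mul_nonneg (by positivity) h.1)]
    push_cast
    exact mul_lt_of_lt_one_right (by positivity) h.2
  rw [radixDigit, pow_succ 2 (n + 1)]
  omega

theorem two_pow_mul_radixRem {y : ℝ} (hy : y ∈ Set.Ico (0 : ℝ) 1) (n : ℕ) :
    2 ^ (n + 1) * radixRem y n = radixDigit y n - 2 ^ (n + 1) + radixRem y (n + 1) := by
  have h := radixRem_mem hy n
  have h1 := Int.floor_add_fract (2 ^ (n + 1) * radixRem y n)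
  rw [← natCast_floor_eq_intCast_floor (mul_nonneg (by positivity) h.1)] at h1
  rw [radixDigit, radixRem]
  push_cast
  linarith

theorem prod_two_pow (n : ℕ) :
    ∏ k ∈ Finset.range n, (2 : ℝ) ^ (k + 1) = 2 ^ ((n : ℝ) * (n + 1) / 2) := by
  induction n with
  | zero => simp
  | succ n ih =>
    rw [Finset.prod_range_succ, ih, ← Real.rpow_natCast, ← Real.rpow_add two_pos]
    congr 1
    push_cast
    ring

theorem abs_sub_le_of_radixDigit_eq {y z : ℝ} (hy : y ∈ Set.Ico (0 : ℝ) 1)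
    (hz : z ∈ Set.Ico (0 : ℝ) 1) {n : ℕ} (h : ∀ k < n, radixDigit y k = radixDigit z k) :
    |y - z| ≤ 2 ^ (-((n : ℝ) * (n + 1) / 2)) := by
  have key : |y - z| * ∏ k ∈ Finset.range n, (2 : ℝ) ^ (k + 1) = |radixRem y n - radixRem z n| := by
    induction n with
    | zero => simp [radixRem]
    | succ n ih =>
      have h1 := two_pow_mul_radixRem hy n
      have h2 := two_pow_mul_radixRem hz n
      have h3 : radixRem y (n + 1) - radixRem z (n + 1) =
          2 ^ (n + 1) * (radixRem y n - radixRem z n) := by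
        rw [h n (by omega)] at h1
        linarith
      rw [Finset.prod_range_succ, ← mul_assoc, ih fun k hk => h k (by omega), h3, abs_mul,
        abs_of_pos (by positivity : (0 : ℝ) < 2 ^ (n + 1)), mul_comm]
  have hy' := radixRem_mem hy n
  have hz' := radixRem_mem hz n
  have h1 : |radixRem y n - radixRem z n| ≤ 1 := by
    rw [abs_le]; constructor <;> linarith [hy'.1, hy'.2, hz'.1, hz'.2]
  rw [prod_two_pow] at key
  rw [Real.rpow_neg two_pos.le, ← one_div, le_div_iff₀ (by positivity), key]
  exact h1

theorem prod_remainders_ge {a : ℕ → ℕ} {x : ℕ → ℝ} (hx : IsOrbit a x)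
    (ha : ∀ k, a k < 2 ^ (k + 2)) (n : ℕ) :
    (2 : ℝ) ^ (-((n : ℝ) * (n + 5) / 2)) ≤ ∏ k ∈ Finset.range n, x k := by
  induction n with
  | zero => simp
  | succ n ih =>
    have h1 : (2 : ℝ) ^ (-((n : ℝ) + 3)) ≤ x n := by
      have h2 := hx.inv_eq n
      have h3 : (a n : ℝ) + 1 ≤ 2 ^ (n + 2) := by exact_mod_cast ha n
      have h4 := hx.lt_one (n + 1)
      have h5 : (1 : ℝ) ≤ 2 ^ (n + 2) := one_le_pow₀ one_le_two
      have h6 : (x n)⁻¹ ≤ 2 ^ (n + 3) := by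
        rw [h2, pow_succ 2 (n + 2)]
        linarith
      rw [Real.rpow_neg two_pos.le]
      refine inv_le_of_inv_le₀ (hx.pos n) (h6.trans_eq ?_)
      rw [← Real.rpow_natCast]
      push_cast
      rfl
    have h7 : -(((n + 1 : ℕ) : ℝ) * ((n + 1 : ℕ) + 5) / 2) =
        -((n : ℝ) * (n + 5) / 2) + -((n : ℝ) + 3) := by
      push_cast
      ring
    rw [Finset.prod_range_succ, h7, Real.rpow_add two_pos]
    exact mul_le_mul ih h1 (by positivity) ((by positivity : (0 : ℝ) ≤ _).trans ih)

/-- At the first disagreement the letters differ by at least 1, and the next remainders, at most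
`1/2`, cancel at most half of this. The `n + 1` remainders of each orbit contribute `(n+1)(n+6)` to
the exponent, and the factor `1/2` one more. -/
theorem abs_sub_ge_of_ne {a b : ℕ → ℕ} {x y : ℕ → ℝ} (hx : IsOrbit a x) (hy : IsOrbit b y)
    (ha : ∀ k, 2 ^ (k + 1) ≤ a k) (hb : ∀ k, 2 ^ (k + 1) ≤ b k)
    (ha' : ∀ k, a k < 2 ^ (k + 2)) (hb' : ∀ k, b k < 2 ^ (k + 2)) {n : ℕ}
    (heq : ∀ k < n, a k = b k) (hne : a n ≠ b n) :
    (2 : ℝ) ^ (-((n : ℝ) ^ 2 + 7 * n + 7)) ≤ |x 0 - y 0| := by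
  have hsmall : ∀ {c : ℕ → ℕ} {w : ℕ → ℝ}, IsOrbit c w → (∀ k, 2 ^ (k + 1) ≤ c k) →
      w (n + 1) ≤ 1 / 2 := by
    intro c w hw hc
    have h1 := hw.inv_eq (n + 1)
    have h2 : (2 : ℝ) ^ (n + 2) ≤ c (n + 1) := by exact_mod_cast hc (n + 1)
    have h3 : (2 : ℝ) ≤ 2 ^ (n + 2) := le_self_pow₀ one_le_two (by omega)
    have h4 := hw.pos (n + 2)
    have h5 : (2 : ℝ) ≤ (w (n + 1))⁻¹ := by
      rw [h1]
      linarith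
    rw [one_div]
    exact le_inv_of_le_inv₀ two_pos h5
  have hx1 := hsmall hx ha
  have hy1 := hsmall hy hb
  have hx0 := hx.pos (n + 1)
  have hy0 := hy.pos (n + 1)
  have hgap : 1 / 2 ≤ |(b n : ℝ) - a n + (y (n + 1) - x (n + 1))| := by
    have h1 : (1 : ℝ) ≤ |(b n : ℝ) - a n| := by
      have : (1 : ℤ) ≤ |(b n : ℤ) - a n| :=
        Int.one_le_abs (sub_ne_zero.mpr (by exact_mod_cast hne.symm))
      exact_mod_cast this
    have h2 : |x (n + 1) - y (n + 1)| ≤ 1 / 2 := by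
      rw [abs_le]; constructor <;> linarith
    have h3 := abs_sub_abs_le_abs_sub ((b n : ℝ) - a n) (x (n + 1) - y (n + 1))
    rw [show (b n : ℝ) - a n + (y (n + 1) - x (n + 1)) =
      (b n : ℝ) - a n - (x (n + 1) - y (n + 1)) by ring]
    linarith
  have hdiff : |x n - y n| =
      x n * y n * |(b n : ℝ) - a n + (y (n + 1) - x (n + 1))| := by
    have h3 := hx.pos n
    have h4 := hy.pos n
    have : (b n : ℝ) - a n + (y (n + 1) - x (n + 1)) = (y n)⁻¹ - (x n)⁻¹ := by
      rw [hx.inv_eq, hy.inv_eq]; ring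
    rw [this, ← abs_of_pos (mul_pos h3 h4), ← abs_mul]
    congr 1
    field_simp
  have hPx := prod_remainders_ge hx ha' (n + 1)
  have hPy := prod_remainders_ge hy hb' (n + 1)
  have hexp : (2 : ℝ) ^ (-((n : ℝ) ^ 2 + 7 * n + 7)) =
      2 ^ (-(((n + 1 : ℕ) : ℝ) * ((n + 1 : ℕ) + 5) / 2)) *
        2 ^ (-(((n + 1 : ℕ) : ℝ) * ((n + 1 : ℕ) + 5) / 2)) * (1 / 2) := by
    rw [show (1 / 2 : ℝ) = 2 ^ (-1 : ℝ) by rw [Real.rpow_neg_one, one_div],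
      ← Real.rpow_add two_pos, ← Real.rpow_add two_pos]
    congr 1
    push_cast
    ring
  rw [hx.abs_sub_eq hy heq, hdiff, hexp]
  have hP0 : 0 ≤ ∏ k ∈ Finset.range (n + 1), x k := Finset.prod_nonneg fun k _ => (hx.pos k).le
  have hQ0 : 0 ≤ ∏ k ∈ Finset.range (n + 1), y k := Finset.prod_nonneg fun k _ => (hy.pos k).le
  have hPQ0 := mul_nonneg hP0 hQ0
  calc _ ≤ (∏ k ∈ Finset.range (n + 1), x k) * (∏ k ∈ Finset.range (n + 1), y k) *
        |(b n : ℝ) - a n + (y (n + 1) - x (n + 1))| := by gcongr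
    _ = _ := by
      rw [Finset.prod_range_succ, Finset.prod_range_succ]
      ring

theorem exists_radixDigit_ne {y z : ℝ} (hy : y ∈ Set.Ico (0 : ℝ) 1) (hz : z ∈ Set.Ico (0 : ℝ) 1)
    (hyz : y ≠ z) : ∃ n, radixDigit y n ≠ radixDigit z n := by
  by_contra! h
  have hlim : Tendsto (fun n : ℕ => (1 / 2 : ℝ) ^ n) atTop (𝓝 0) :=
    tendsto_pow_atTop_nhds_zero_of_lt_one (by norm_num) (by norm_num)
  have hle : ∀ n : ℕ, |y - z| ≤ (1 / 2 : ℝ) ^ n := by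
    intro n
    refine (abs_sub_le_of_radixDigit_eq hy hz (n := n) fun k _ => h k).trans ?_
    rw [one_div, inv_pow, ← Real.rpow_natCast, ← Real.rpow_neg two_pos.le]
    refine Real.rpow_le_rpow_of_exponent_le one_le_two ?_
    have : (n : ℝ) ≤ n ^ 2 := by exact_mod_cast Nat.le_self_pow two_ne_zero n
    linarith
  have h0 := ge_of_tendsto' hlim hle
  exact hyz (sub_eq_zero.mp (abs_eq_zero.mp (le_antisymm h0 (abs_nonneg _))))

/-- Two orbits with mixed radix digits separate polynomially, with exponent close to one half. -/
theorem abs_sub_le_of_isOrbit_radixDigit {s : ℝ} (hs0 : 0 < s) (hs : s < 1 / 2) {y z : ℝ}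
    (hy : y ∈ Set.Ico (0 : ℝ) 1) (hz : z ∈ Set.Ico (0 : ℝ) 1) {v w : ℕ → ℝ}
    (hv : IsOrbit (radixDigit y) v) (hw : IsOrbit (radixDigit z) w) :
    |y - z| ≤ 2 ^ (4 + 9 / (2 * (1 - 2 * s))) * |v 0 - w 0| ^ s := by
  rcases eq_or_ne y z with rfl | hyz
  · rw [sub_self, abs_zero]
    positivity
  classical
  have hex := exists_radixDigit_ne hy hz hyz
  set n := Nat.find hex with hn
  have hne : radixDigit y n ≠ radixDigit z n := Nat.find_spec hex
  have heq : ∀ k < n, radixDigit y k = radixDigit z k := fun k hk =>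
    not_not.mp (Nat.find_min hex hk)
  have hsep := abs_sub_ge_of_ne hv hw (fun k => Nat.le_add_right _ _)
    (fun k => Nat.le_add_right _ _) (radixDigit_lt hy) (radixDigit_lt hz) heq hne
  refine (abs_sub_le_of_radixDigit_eq hy hz heq).trans ?_
  calc _ ≤ (2 : ℝ) ^ (4 + 9 / (2 * (1 - 2 * s)) + -((n : ℝ) ^ 2 + 7 * n + 7) * s) := by
        refine Real.rpow_le_rpow_of_exponent_le one_le_two ?_
        have ht : 0 < 1 - 2 * s := by linarith
        -- Completing the square bounds `3n - (1 - 2s)n²/2` by `9/(2(1 - 2s))`. The term 4 in the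
        -- constant covers `7s < 7/2`.
        have hsq : 0 ≤ ((1 - 2 * s) * n - 3) ^ 2 / (2 * (1 - 2 * s)) := by positivity
        have hsq' : ((1 - 2 * s) * n - 3) ^ 2 / (2 * (1 - 2 * s)) =
            (1 - 2 * s) * n ^ 2 / 2 - 3 * n + 9 / (2 * (1 - 2 * s)) := by
          field_simp
          ring
        have hn0 : (0 : ℝ) ≤ n := n.cast_nonneg
        nlinarith [mul_nonneg ht.le hn0]
    _ = 2 ^ (4 + 9 / (2 * (1 - 2 * s))) * ((2 : ℝ) ^ (-((n : ℝ) ^ 2 + 7 * n + 7))) ^ s := by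
        rw [Real.rpow_add two_pos, Real.rpow_mul two_pos.le]
    _ ≤ _ := by gcongr

/-! ### Summability for rapidly growing quotients -/

theorem log_wordDen_ge {a : ℕ → ℕ} (ha : ∀ k, 2 ^ (k + 1) ≤ a k) (n : ℕ) :
    (n : ℝ) ^ 2 / 4 ≤ Real.log (wordDen (hist a n)) := by
  have h : ∏ k ∈ Finset.range n, (2 : ℝ) ^ (k + 1) ≤ wordDen (hist a n) := by
    induction n with
    | zero => simp [hist, wordDen]
    | succ n ih =>
      rw [Finset.prod_range_succ, hist, wordDen]
      have h1 : (2 : ℝ) ^ (n + 1) ≤ a n := by exact_mod_cast ha n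
      have h2 := invRatio_nonneg (hist a n)
      have h3 := wordDen_pos (hist a n)
      gcongr
      linarith
  rw [prod_two_pow] at h
  have h1 := Real.log_le_log (by positivity) h
  rw [Real.log_rpow two_pos] at h1
  have h2 := Real.log_two_gt_d9
  have hn0 : (0 : ℝ) ≤ n := n.cast_nonneg
  nlinarith

/-- In the first case the growth is below `2 log q`. In the second the inner quotient is at least 2,
and `log (log 2) ≥ -1`. -/
theorem IsOrbit.W_le {a : ℕ → ℕ} {x : ℕ → ℝ} (h : IsOrbit a x) {n : ℕ}
    (hL : 1 ≤ Real.log (wordDen (hist a n))) :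
    W (x 0) n ≤ (1 + Real.log (Real.log (wordDen (hist a n)))) /
      Real.log (wordDen (hist a n)) := by
  unfold W
  simp only [h.cfDen_eq]
  set q := wordDen (hist a n) with hq
  set q' := wordDen (hist a (n + 1)) with hq'
  have hq0 : 0 < q := wordDen_pos _
  have hq0' : 0 < q' := wordDen_pos _
  have h2 := Real.log_two_lt_d9
  have h2' := Real.log_two_gt_d9
  have hLL := Real.log_nonneg hL
  split_ifs with hc
  · gcongr
    have h1 := Real.log_le_log hq0' hc.le
    rw [Real.log_mul (by positivity) (by positivity), Real.log_mul two_ne_zero hq0.ne'] at h1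
    linarith
  · gcongr
    refine max_le (by linarith) ?_
    have h3 : 2 ≤ q' / (q * Real.log q) := by
      rw [le_div_iff₀ (by positivity)]
      linarith
    have h4 := Real.log_le_log two_pos h3
    have h5 := Real.log_le_log (by linarith) h4
    have h6 := Real.one_sub_inv_le_log_of_pos (by linarith : 0 < Real.log 2)
    have h7 : (Real.log 2)⁻¹ ≤ 2 := inv_le_of_inv_le₀ two_pos (by linarith)
    linarith

/-- From `log L = 4 log (L ^ (1/4)) ≤ 4 (L ^ (1/4) - 1)`. With `L ≥ n²/4` the exponent `-3/4`
becomes the summable `n ^ (-3/2)`. -/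
theorem one_add_log_div_le {L : ℝ} (hL : 0 < L) :
    (1 + Real.log L) / L ≤ 4 * L ^ (-(3 / 4) : ℝ) := by
  have h1 := Real.log_le_sub_one_of_pos (Real.rpow_pos_of_pos hL (1 / 4))
  rw [Real.log_rpow hL] at h1
  have h2 : L ^ (-(3 / 4) : ℝ) * L = L ^ (1 / 4 : ℝ) := by
    nth_rewrite 2 [← Real.rpow_one L]
    rw [← Real.rpow_add hL]
    norm_num
  rw [div_le_iff₀ hL, mul_assoc, h2]
  linarith

theorem IsOrbit.summable_W {a : ℕ → ℕ} {x : ℕ → ℝ} (h : IsOrbit a x)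
    (ha : ∀ k, 2 ^ (k + 1) ≤ a k) : Summable (W (x 0)) := by
  have hsum : Summable fun n : ℕ => 4 * (1 / 4 : ℝ) ^ (-(3 / 4) : ℝ) * (n : ℝ) ^ (-(3 / 2) : ℝ) :=
    (Real.summable_nat_rpow.mpr (by norm_num)).mul_left _
  refine hsum.of_norm_bounded_eventually_nat ?_
  filter_upwards [eventually_ge_atTop 2] with n hn
  rw [Real.norm_of_nonneg (h.W_nonneg n)]
  have hn2 : (2 : ℝ) ≤ n := by exact_mod_cast hn
  have hLn := log_wordDen_ge ha n
  have hL1 : 1 ≤ Real.log (wordDen (hist a n)) := by nlinarith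
  refine (h.W_le hL1).trans ((one_add_log_div_le (by linarith)).trans ?_)
  rw [mul_assoc]
  gcongr
  calc _ ≤ ((n : ℝ) ^ 2 / 4) ^ (-(3 / 4) : ℝ) :=
        Real.rpow_le_rpow_of_nonpos (by positivity) hLn (by norm_num)
    _ = _ := by
        rw [div_eq_inv_mul, Real.mul_rpow (by norm_num) (by positivity), ← Real.rpow_two,
          ← Real.rpow_mul (by positivity)]
        norm_num

/-! ### The lower bound and the conclusion -/

theorem le_dimH_finiteWSet_of_lt_half {s : ℝ≥0} (hs0 : 0 < s) (hs : (s : ℝ) < 1 / 2) :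
    (s : ℝ≥0∞) ≤ dimH finiteWSet := by
  choose x hx using fun y => exists_isOrbit (radixDigit y)
  have hle := dimH_le_of_abs_sub_le (A := Set.Ico (0 : ℝ) 1) (g := fun y => x y 0)
    (C := (2 : ℝ≥0) ^ (4 + 9 / (2 * (1 - 2 * (s : ℝ))))) hs0 fun y hy z hz => by
      simpa using abs_sub_le_of_isOrbit_radixDigit hs0 hs hy hz (hx y) (hx z)
  have hsub : (fun y => x y 0) '' Set.Ico (0 : ℝ) 1 ⊆ finiteWSet := by
    rintro _ ⟨y, -, rfl⟩
    exact ⟨⟨(hx y).pos 0, (hx y).lt_one 0⟩, (hx y).irrational,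
      (summable_nat_add_iff 1).mpr ((hx y).summable_W fun k => Nat.le_add_right _ _)⟩
  have hone : dimH (Set.Ico (0 : ℝ) 1) = 1 := by
    rw [Real.dimH_of_nonempty_interior (by simp)]
    simp
  rw [hone] at hle
  have h1 : (1 : ℝ≥0∞) ≤ dimH finiteWSet / s :=
    hle.trans (ENNReal.div_le_div_right (dimH_mono hsub) _)
  rwa [ENNReal.le_div_iff_mul_le (by simp [hs0.ne']) (by simp), one_mul] at h1

theorem half_le_dimH_finiteWSet : 1 / 2 ≤ dimH finiteWSet := by
  refine le_of_forall_lt_imp_le_of_dense fun c hc => ?_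
  lift c to ℝ≥0 using (hc.trans_le le_top).ne
  rcases eq_or_ne c 0 with rfl | hc0
  · simp
  refine le_dimH_finiteWSet_of_lt_half (pos_iff_ne_zero.mpr hc0) ?_
  have h2 : (c : ℝ≥0∞) < ((1 / 2 : ℝ≥0) : ℝ≥0∞) := by
    rw [ENNReal.coe_div two_ne_zero]
    simpa using hc
  have h3 : c < (1 / 2 : ℝ≥0) := ENNReal.coe_lt_coe.mp h2
  exact_mod_cast h3

theorem mainTheorem2 :
    MeasureTheory.volume finiteWSet = 0 ∧ dimH finiteWSet = 1 / 2 :=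
  ⟨volume_finiteWSet, le_antisymm dimH_finiteWSet_le half_le_dimH_finiteWSet⟩
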